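/- Let $\mathfrak g=\mathfrak g_{\bar 0}\oplus\mathfrak g_{\bar 1}$ be a finite-dimensional complex Lie superalgebra which is perfect, i.e. $[\mathfrak g,\mathfrak g]=\mathfrak g$, and whose even part $\mathfrak g_{\bar 0}$ is a reductive Lie algebra. Let $\mathfrak g_0=[\mathfrak g_{\bar 0},\mathfrak g_{\bar 0}]$, and assume that the space $$Z_{\mathfrak g_{\bar 1}}(\mathfrak g_0)=\{v\in\mathfrak g_{\bar 1}\mid [x,v]=0\ \text{for all } x\in\mathfrak g_0\}$$ has dimension at most one. A bilinear map $\delta:\mathfrak g\times\mathfrak g\to\mathfrak g$ that is homogeneous of parity $|\delta|\in\mathbb Z/2$ (that is, $\delta(\mathfrak g_i,\mathfrak g_j)\subseteq\mathfrak g_{|\delta|+i+j}$ for all $i,j\in\mathbb Z/2$) is called a super-biderivation of $\mathfrak g$ if $$\delta([x,y],z)=(-1)^{|\delta||x|}[x,\delta(y,z)]-(-1)^{|y|(|\delta|+|x|)}[y,\delta(x,z)],$$ $$\delta(x,[y,z])=(-1)^{(|\delta|+|x|)|y|}[y,\delta(x,z)]-(-1)^{|z|(|\delta|+|x|+|y|)}[z,\delta(x,y)]$$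 for all homogeneous $x,y,z\in\mathfrak g$, and it is called super-symmetric if $\delta(x,y)=(-1)^{|x||y|}\delta(y,x)$ for all homogeneous $x,y\in\mathfrak g$. Then every super-symmetric super-biderivation $\delta$ of $\mathfrak g$, of either parity, is zero. -/

import Mathlib

/-- A complex Lie superalgebra: a `ℤ/2`-graded complex vector space `L = L₀ ⊕ L₁` with a bilinear
bracket that is compatible with the grading, super-skew-symmetric, and satisfies the super Jacobi
identity. Here `(-1 : ℤˣ) ^ a`, for `a : ZMod 2`, is the usual sign. -/
class LieSuperalgebra (L : Type*) [AddCommGroup L] [Module ℂ L] extends Bracket L L where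
  /-- The homogeneous components of the superalgebra: `grade 0` is even, `grade 1` is odd. -/
  grade : ZMod 2 → Submodule ℂ L
  isCompl_grade : IsCompl (grade 0) (grade 1)
  add_bracket : ∀ x y z : L, ⁅x + y, z⁆ = ⁅x, z⁆ + ⁅y, z⁆
  bracket_add : ∀ x y z : L, ⁅x, y + z⁆ = ⁅x, y⁆ + ⁅x, z⁆
  smul_bracket : ∀ (c : ℂ) (x y : L), ⁅c • x, y⁆ = c • ⁅x, y⁆
  bracket_smul : ∀ (c : ℂ) (x y : L), ⁅x, c • y⁆ = c • ⁅x, y⁆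
  bracket_mem : ∀ {i j : ZMod 2} {x y : L}, x ∈ grade i → y ∈ grade j → ⁅x, y⁆ ∈ grade (i + j)
  super_skew : ∀ {i j : ZMod 2} {x y : L}, x ∈ grade i → y ∈ grade j →
    ⁅x, y⁆ = -((-1 : ℤˣ) ^ (i * j) • ⁅y, x⁆)
  super_jacobi : ∀ {i j k : ZMod 2} {x y z : L}, x ∈ grade i → y ∈ grade j → z ∈ grade k →
    ⁅x, ⁅y, z⁆⁆ = ⁅⁅x, y⁆, z⁆ + (-1 : ℤˣ) ^ (i * j) • ⁅y, ⁅x, z⁆⁆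

namespace LieSuperalgebra

/-- A finite-dimensional (ordinary) complex Lie algebra is reductive if its radical equals
its center. -/
def IsReductiveLieAlgebra (A : Type*) [LieRing A] [LieAlgebra ℂ A] : Prop :=
  LieAlgebra.radical ℂ A = LieAlgebra.center ℂ A

section

variable (L : Type*) [AddCommGroup L] [Module ℂ L] [LieSuperalgebra L]

/-- The even part of a Lie superalgebra. -/
abbrev even : Submodule ℂ L := grade 0

/-- The odd part of a Lie superalgebra. -/
abbrev odd : Submodule ℂ L := grade 1

/-- The even part is an ordinary Lie algebra under the restriction of the bracket. -/
instance instLieRingEven : LieRing (even L) where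
  bracket x y := ⟨⁅(x : L), (y : L)⁆, by simpa using bracket_mem x.2 y.2⟩
  add_lie x y z := Subtype.ext (add_bracket (x : L) y z)
  lie_add x y z := Subtype.ext (bracket_add (x : L) y z)
  lie_self x := by
    apply Subtype.ext
    have h := super_skew x.2 x.2
    simp only [mul_zero, uzpow_zero, one_smul] at h
    have h2 : (2 : ℂ) • ⁅(x : L), (x : L)⁆ = 0 := by
      rw [two_smul]
      exact eq_neg_iff_add_eq_zero.mp h
    exact (smul_eq_zero.mp h2).resolve_left two_ne_zero
  leibniz_lie x y z := by
    apply Subtype.ext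
    have h := super_jacobi x.2 y.2 z.2
    simp only [mul_zero, uzpow_zero, one_smul] at h
    exact h

instance instLieAlgebraEven : LieAlgebra ℂ (even L) where
  lie_smul c x y := Subtype.ext (bracket_smul c (x : L) y)

/-- A Lie superalgebra `L` is perfect if `[L, L] = L`, where `[L, L]` is the linear span of all
brackets. -/
def IsPerfect : Prop :=
  Submodule.span ℂ {z : L | ∃ x y : L, ⁅x, y⁆ = z} = ⊤

/-- The derived algebra `[L₀, L₀]` of the even part `L₀`, a Lie ideal of `L₀`. -/
abbrev derivedEven : LieIdeal ℂ (even L) :=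
  ⁅(⊤ : LieIdeal ℂ (even L)), (⊤ : LieIdeal ℂ (even L))⁆

/-- The subspace of all odd `v` with `[x, v] = 0` for all `x ∈ [L₀, L₀]`. -/
def oddInvariants : Submodule ℂ L where
  carrier := {v | v ∈ odd L ∧ ∀ x ∈ derivedEven L, ⁅(x : L), v⁆ = 0}
  add_mem' := by
    rintro a b ⟨ha, ha'⟩ ⟨hb, hb'⟩
    exact ⟨add_mem ha hb, fun x hx => by rw [bracket_add, ha' x hx, hb' x hx, add_zero]⟩
  zero_mem' := ⟨zero_mem _, fun x _ => by simpa using bracket_smul (0 : ℂ) (x : L) (0 : L)⟩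
  smul_mem' := by
    rintro c a ⟨ha, ha'⟩
    exact ⟨Submodule.smul_mem _ c ha, fun x hx => by rw [bracket_smul, ha' x hx, smul_zero]⟩

end

section

variable {L : Type*} [AddCommGroup L] [Module ℂ L] [LieSuperalgebra L]

/-- A bilinear map `δ : L × L → L`, homogeneous of parity `d`, is a super-biderivation if it
satisfies the two super-derivation identities below on homogeneous elements. -/
structure IsSuperBiderivation (d : ZMod 2) (δ : L →ₗ[ℂ] L →ₗ[ℂ] L) : Prop where
  map_mem : ∀ {i j : ZMod 2} {x y : L}, x ∈ grade i → y ∈ grade j → δ x y ∈ grade (d + i + j)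
  left_derivation : ∀ {i j k : ZMod 2} {x y z : L}, x ∈ grade i → y ∈ grade j → z ∈ grade k →
    δ ⁅x, y⁆ z = (-1 : ℤˣ) ^ (d * i) • ⁅x, δ y z⁆ - (-1 : ℤˣ) ^ (j * (d + i)) • ⁅y, δ x z⁆
  right_derivation : ∀ {i j k : ZMod 2} {x y z : L}, x ∈ grade i → y ∈ grade j → z ∈ grade k →
    δ x ⁅y, z⁆ =
      (-1 : ℤˣ) ^ ((d + i) * j) • ⁅y, δ x z⁆ - (-1 : ℤˣ) ^ (k * (d + i + j)) • ⁅z, δ x y⁆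

/-- A bilinear map `δ` is super-symmetric if `δ(x, y) = (-1)^{|x||y|} δ(y, x)` for homogeneous
`x` and `y`. -/
def IsSuperSymmetric (δ : L →ₗ[ℂ] L →ₗ[ℂ] L) : Prop :=
  ∀ ⦃i j : ZMod 2⦄ ⦃x y : L⦄, x ∈ grade i → y ∈ grade j → δ x y = (-1 : ℤˣ) ^ (i * j) • δ y x

end

end LieSuperalgebra

/-! Write `s` for `derivedEven L`, a semisimple Lie algebra because `even L` is reductive. The proof
shows that `δ` vanishes on `s` and then propagates this through the `s`-module `L`.

On `s × s`, `δ` is a symmetric biderivation with values in a module, and such a map is zero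
(`biderivation_eq_zero_of_symm`): for a Casimir operator `Ω` there is a vector `w` with `Ω δ(x,y) =
x(y w)`; symmetry makes `s = [s,s]` kill `w`, so all Casimir operators kill the values, which are
therefore `s`-invariant, and the derivation rule gives zero. A symmetry argument extends this to
`δ(s, L) = 0` (`apply_derivedEven`). Then `s` commutes with `δ` in each variable separately, so two
elements of `s` act on `δ(v,w)` in either order with the same result, and `s = [s,s]` kills all
values of `δ`.

Now use `L = [s,L] ⊕ Lˢ` (`isCompl_lie_top_maxTrivSubmodule`). `δ` kills `[s,L]`. If `u` is odd in
`[s,L]`, then `δ([u,v],w) = ±[u,δ(v,w)]` lies in both summands, so it is zero. The odd part of `Lˢ`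
is spanned by one vector `v`, and perfectness forces `[v,v] = 0`
(`bracket_self_eq_zero_of_oddInvariants`). Hence `δ` kills `[odd, odd]`, and by perfectness the
whole even part. Only `δ(v,v)` remains, and super-symmetry makes it its own negative. -/

open scoped TensorProduct

/-! ### Semisimple Lie algebras: perfect ideals and Casimir elements -/

namespace LieAlgebra

variable {K : Type*} [Field K]

/-- The part of `I` that is Killing-orthogonal to `[I,I]` has its bracket in `[I,I] ∩ [I,I]^⊥ = 0`;
it is an abelian ideal, hence zero. -/
lemma lieIdeal_lie_self_eq [CharZero K] {s : Type*} [LieRing s] [LieAlgebra K s] [FiniteDimensional K s]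
    [HasTrivialRadical K s] (I : LieIdeal K s) : ⁅I, I⁆ = I := by
  refine le_antisymm (LieSubmodule.lie_le_left I I) fun x hx ↦ ?_
  have hc := LieIdeal.isCompl_killingCompl ⁅I, I⁆
  have hC : I ⊓ LieIdeal.killingCompl K s ⁅I, I⁆ = ⊥ := by
    refine (hasTrivialRadical_iff_no_abelian_ideals K s).mp inferInstance _ ?_
    rw [LieSubmodule.lie_abelian_iff_lie_self_eq_bot, eq_bot_iff, ← hc.inf_eq_bot]
    exact le_inf (LieSubmodule.mono_lie inf_le_left inf_le_left)
      ((LieSubmodule.lie_le_left _ _).trans inf_le_right)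
  obtain ⟨d, hd, c, hcm, rfl⟩ := (LieSubmodule.mem_sup _ _ _).mp (hc.sup_eq_top ▸ LieSubmodule.mem_top x)
  have hcI : c ∈ I := by
    have := I.sub_mem hx (LieSubmodule.lie_le_left I I hd)
    simpa using this
  have : c ∈ (⊥ : LieIdeal K s) := hC ▸ ⟨hcI, hcm⟩
  rw [(LieSubmodule.mem_bot c).mp this, add_zero]
  exact hd

/-- Since `[y,z]m = y(zm) - z(ym)`, perfectness gives `sV ⊆ s(sV)`: the lower central series is
constant from its first term on, and nilpotency makes that term zero. -/
lemma isTrivial_of_isNilpotent_of_perfect {s V : Type*} [LieRing s] [LieAlgebra K s]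
    [AddCommGroup V] [Module K V] [LieRingModule s V] [LieModule K s V]
    (hs : ⁅(⊤ : LieIdeal K s), (⊤ : LieIdeal K s)⁆ = ⊤) [LieModule.IsNilpotent s V] :
    LieModule.IsTrivial s V := by
  have key : ⁅(⊤ : LieIdeal K s), (⊤ : LieSubmodule K s V)⁆ ≤
      ⁅(⊤ : LieIdeal K s), ⁅(⊤ : LieIdeal K s), (⊤ : LieSubmodule K s V)⁆⁆ := by
    rw [LieSubmodule.lie_le_iff]
    intro x _ m _
    have hx' : x ∈ (⁅(⊤ : LieIdeal K s), (⊤ : LieIdeal K s)⁆ : LieIdeal K s).toSubmodule := by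
      rw [hs]; trivial
    clear * - hx'
    rw [LieSubmodule.lieIdeal_oper_eq_linear_span'] at hx'
    induction hx' using Submodule.span_induction with
    | mem x h =>
      obtain ⟨y, -, z, -, rfl⟩ := h
      rw [lie_lie]
      have h (u w : s) : ⁅u, ⁅w, m⁆⁆ ∈
          ⁅(⊤ : LieIdeal K s), ⁅(⊤ : LieIdeal K s), (⊤ : LieSubmodule K s V)⁆⁆ :=
        LieSubmodule.lie_mem_lie trivial (LieSubmodule.lie_mem_lie trivial trivial)
      exact sub_mem (h y z) (h z y)
    | zero => simp
    | add x y _ _ hx hy => rw [add_lie]; exact add_mem hx hy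
    | smul c x _ hx => rw [smul_lie]; exact Submodule.smul_mem _ c hx
  have h1 (k : ℕ) : ⁅(⊤ : LieIdeal K s), (⊤ : LieSubmodule K s V)⁆ ≤
      LieModule.lowerCentralSeries K s V k := by
    have h2 (k : ℕ) : LieModule.lowerCentralSeries K s V (k + 1) ≤
        LieModule.lowerCentralSeries K s V (k + 2) := by
      induction k with
      | zero => simpa [LieModule.lowerCentralSeries_succ] using key
      | succ k ih =>
        rw [LieModule.lowerCentralSeries_succ, LieModule.lowerCentralSeries_succ K s V (k + 2)]
        exact LieSubmodule.mono_lie_right _ ih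
    induction k with
    | zero => simp
    | succ k ih =>
      cases k with
      | zero => simp [LieModule.lowerCentralSeries_succ]
      | succ k => exact ih.trans (h2 k)
  obtain ⟨k, hk⟩ := (LieModule.isNilpotent_iff K s V).mp inferInstance
  refine ⟨fun x m ↦ ?_⟩
  have := h1 k (LieSubmodule.lie_mem_lie (I := ⊤) (N := ⊤) (LieSubmodule.mem_top x)
    (LieSubmodule.mem_top m))
  rwa [hk, LieSubmodule.mem_bot] at this

variable {s : Type*} [LieRing s] [LieAlgebra K s]

/-- A form of Cartan's criterion: a vanishing trace form makes the derived ideal of `I` act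
nilpotently, and `I` is its own derived ideal. -/
lemma lie_eq_zero_of_traceForm_eq_zero [CharZero K] {V : Type*} [FiniteDimensional K s] [HasTrivialRadical K s]
    [AddCommGroup V] [Module K V] [LieRingModule s V] [LieModule K s V] [FiniteDimensional K V]
    (I : LieIdeal K s) (h : LieModule.traceForm K I V = 0) {x : s} (hx : x ∈ I) (v : V) :
    ⁅x, v⁆ = 0 := by
  have htop : derivedSeries K I 1 = ⊤ := by
    rw [LieIdeal.derivedSeries_eq_derivedSeriesOfIdeal_comap]
    simp [derivedSeriesOfIdeal_succ, lieIdeal_lie_self_eq]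
  have hn := LieModule.isNilpotent_derivedSeries_of_traceForm_eq_zero h
  have hn' : LieModule.IsNilpotent I V := by
    rw [LieModule.isNilpotent_iff_forall' (R := K)] at hn ⊢
    exact fun y ↦ hn ⟨y, htop ▸ LieSubmodule.mem_top y⟩
  have := isTrivial_of_isNilpotent_of_perfect (K := K) (s := I) (V := V) htop
  exact LieModule.IsTrivial.trivial (L := I) ⟨x, hx⟩ v

variable (K) in
/-- Two families whose tensor `∑ i, a i ⊗ b i` is symmetric and invariant under the Lie algebra. -/
structure IsCasimirPair {n : ℕ} (a b : Fin n → s) : Prop where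
  invariant : ∀ x : s, ∑ i, (⁅x, a i⁆ ⊗ₜ[K] b i + a i ⊗ₜ[K] ⁅x, b i⁆) = 0
  symm : ∑ i, a i ⊗ₜ[K] b i = ∑ i, b i ⊗ₜ[K] a i

namespace IsCasimirPair

/-- The situation of dual bases for an invariant symmetric form: `s` acts on them by matrices that
are negative transposes of each other, and `g` is the Gram matrix. -/
lemma of_expansion {n : ℕ} {a b : Fin n → s} (c : s → Fin n → Fin n → K) (g : Fin n → Fin n → K)
    (ha : ∀ x i, ⁅x, a i⁆ = ∑ j, c x i j • a j) (hb : ∀ x i, ⁅x, b i⁆ = - ∑ j, c x j i • b j)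
    (hab : ∀ i, a i = ∑ j, g i j • b j) (hg : ∀ i j, g i j = g j i) : IsCasimirPair K a b where
  invariant x := by
    simp_rw [ha, hb, TensorProduct.sum_tmul, TensorProduct.tmul_neg, TensorProduct.tmul_sum,
      TensorProduct.tmul_smul, ← TensorProduct.smul_tmul']
    rw [Finset.sum_add_distrib, Finset.sum_comm, Finset.sum_neg_distrib, add_neg_cancel]
  symm := by
    simp_rw [hab, TensorProduct.sum_tmul, TensorProduct.tmul_sum,
      TensorProduct.tmul_smul, ← TensorProduct.smul_tmul']
    rw [Finset.sum_comm]
    simp_rw [hg]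

variable {n : ℕ} {a b : Fin n → s} (h : IsCasimirPair K a b)
  {V : Type*} [AddCommGroup V] [Module K V]

include h

lemma sum_lie_left (f : s →ₗ[K] s →ₗ[K] V) (x : s) :
    ∑ i, f ⁅x, a i⁆ (b i) = - ∑ i, f (a i) ⁅x, b i⁆ := by
  have := congrArg (TensorProduct.lift f) (h.invariant x)
  simp only [map_sum, map_add, TensorProduct.lift.tmul, map_zero, Finset.sum_add_distrib] at this
  exact eq_neg_of_add_eq_zero_left this

lemma sum_comm (f : s →ₗ[K] s →ₗ[K] V) : ∑ i, f (a i) (b i) = ∑ i, f (b i) (a i) := by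
  simpa only [map_sum, TensorProduct.lift.tmul] using congrArg (TensorProduct.lift f) h.symm

end IsCasimirPair

/-- The radical `N` of the trace form acts by zero, and the form is nondegenerate on the Killing
complement `J` of `N`. Dual bases of `J` give an operator of trace `dim J`, which is nonzero unless
`N = s`. -/
lemma exists_isCasimirPair [CharZero K] {V : Type*} [FiniteDimensional K s] [HasTrivialRadical K s]
    [AddCommGroup V] [Module K V] [LieRingModule s V] [LieModule K s V] [FiniteDimensional K V]
    (hV : ¬ LieModule.IsTrivial s V) :
    ∃ (n : ℕ) (a b : Fin n → s), IsCasimirPair K a b ∧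
      LinearMap.trace K V (∑ i, LieModule.toEnd K s V (a i) ∘ₗ LieModule.toEnd K s V (b i)) ≠ 0 := by
  set B := LieModule.traceForm K s V with hB
  let N : LieIdeal K s := InvariantForm.orthogonal B (LieModule.traceForm_lieInvariant K s V) ⊤
  have hN {x : s} : x ∈ N ↔ ∀ y, B y x = 0 := by
    simp [N, InvariantForm.mem_orthogonal]
  have hNV {x : s} (hx : x ∈ N) (v : V) : ⁅x, v⁆ = 0 := by
    refine lie_eq_zero_of_traceForm_eq_zero N ?_ hx v
    ext ⟨y, hy⟩ ⟨z, hz⟩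
    exact hN.mp hz y
  let J := LieIdeal.killingCompl K s N
  have hc : IsCompl N J := LieIdeal.isCompl_killingCompl N
  let BJ : LinearMap.BilinForm K J := B.restrict J.toSubmodule
  have hBJ (x y : J) : BJ x y = B x y := rfl
  have hsymB (x y : s) : B x y = B y x := LieModule.traceForm_comm K s V x y
  have hsymm : BJ.IsSymm := ⟨fun x y ↦ by simpa [hBJ] using hsymB x y⟩
  have hnd : BJ.Nondegenerate := by
    refine hsymm.isRefl.nondegenerate_iff_separatingLeft.mpr ?_
    intro x hx
    have hxN : (x : s) ∈ N := by
      rw [hN]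
      intro y
      obtain ⟨d, hd, c, hcm, rfl⟩ :=
        (LieSubmodule.mem_sup _ _ _).mp (hc.sup_eq_top ▸ LieSubmodule.mem_top y)
      have h1 : B x d = 0 := hN.mp hd x
      have h2 : B x c = 0 := hx ⟨c, hcm⟩
      rw [hsymB, map_add, h1, h2, add_zero]
    have : (x : s) ∈ N ⊓ J := ⟨hxN, x.2⟩
    rw [hc.inf_eq_bot, LieSubmodule.mem_bot] at this
    exact Subtype.ext this
  let e := Module.finBasis K J
  let e' := BJ.dualBasis hnd e
  have hee' (i j) : BJ (e i) (e' j) = if i = j then 1 else 0 :=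
    LinearMap.BilinForm.apply_dualBasis_right hnd hsymm e i j
  have hexp (x : J) : (x : s) = ∑ j, BJ x (e' j) • (e j : s) := by
    have h1 (j) : e.repr x j = BJ x (e' j) := by
      conv_lhs => rw [← LinearMap.BilinForm.dualBasis_dualBasis hnd hsymm e]
      exact LinearMap.BilinForm.dualBasis_repr_apply hnd _ x j
    conv_lhs => rw [← e.sum_repr x]
    simp [h1]
  have hexp' (x : J) : (x : s) = ∑ j, BJ x (e j) • (e' j : s) := by
    conv_lhs => rw [← e'.sum_repr x]
    simp [e', LinearMap.BilinForm.dualBasis_repr_apply]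
  refine ⟨_, fun i ↦ (e i : s), fun i ↦ (e' i : s), IsCasimirPair.of_expansion
    (fun x i j ↦ B ⁅x, (e i : s)⁆ (e' j)) (fun i j ↦ B (e i) (e j)) ?_ ?_ ?_ ?_, ?_⟩
  · exact fun x i ↦ hexp ⟨⁅x, (e i : s)⁆, J.lie_mem (e i).2⟩
  · intro x i
    refine (hexp' ⟨⁅x, (e' i : s)⁆, J.lie_mem (e' i).2⟩).trans ?_
    rw [← Finset.sum_neg_distrib]
    refine Finset.sum_congr rfl fun j _ ↦ ?_
    rw [← neg_smul]
    congr 1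
    rw [LieModule.traceForm_lieInvariant K s V, neg_neg, hsymB]
    rfl
  · exact fun i ↦ hexp' (e i)
  · exact fun i j ↦ hsymB _ _
  · have h1 : LinearMap.trace K V
        (∑ i, LieModule.toEnd K s V (e i) ∘ₗ LieModule.toEnd K s V (e' i)) =
        (Module.finrank K J : K) := by
      rw [map_sum]
      calc _ = ∑ i, BJ (e i) (e' i) := rfl
        _ = _ := by simp [hee']
    rw [h1, Nat.cast_ne_zero]
    intro h0
    refine hV ⟨fun x v ↦ hNV ?_ v⟩
    have hJ : J = ⊥ := by
      rw [← LieSubmodule.toSubmodule_eq_bot]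
      exact Submodule.finrank_eq_zero.mp h0
    rw [hJ] at hc
    have := hc.sup_eq_top
    rw [sup_bot_eq] at this
    rw [this]
    trivial

end LieAlgebra

/-! ### Casimir operators, symmetric biderivations into a module, and `V = sV ⊕ Vˢ` -/

namespace LieAlgebra

variable {K : Type*} [Field K] {s : Type*} [LieRing s] [LieAlgebra K s]
  {V : Type*} [AddCommGroup V] [Module K V] [LieRingModule s V] [LieModule K s V]

namespace IsCasimirPair

variable {n : ℕ} {a b : Fin n → s}

/-- The operator `∑ i, a i * b i` on a module, as a morphism of Lie modules. -/
def operator (h : IsCasimirPair K a b) (V : Type*) [AddCommGroup V] [Module K V]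
    [LieRingModule s V] [LieModule K s V] : V →ₗ⁅K,s⁆ V where
  toLinearMap := ∑ i, LieModule.toEnd K s V (a i) ∘ₗ LieModule.toEnd K s V (b i)
  map_lie' := by
    intro x v
    have h1 := h.sum_lie_left (V := V) (LinearMap.mk₂ K (fun y z : s ↦ ⁅y, ⁅z, v⁆⁆)
      (by simp) (by simp) (by simp) (by simp)) x
    simp only [LinearMap.mk₂_apply] at h1
    simp only [AddHom.toFun_eq_coe, LinearMap.coe_toAddHom, LinearMap.sum_apply,
      LinearMap.comp_apply, LieModule.toEnd_apply_apply, lie_sum]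
    simp_rw [leibniz_lie x (a _), leibniz_lie x (b _), lie_add]
    rw [Finset.sum_add_distrib, Finset.sum_add_distrib, h1]
    abel

lemma operator_apply (h : IsCasimirPair K a b) (v : V) :
    h.operator V v = ∑ i, ⁅a i, ⁅b i, v⁆⁆ := by
  change (∑ i, LieModule.toEnd K s V (a i) ∘ₗ LieModule.toEnd K s V (b i)) v = _
  simp

/-- The generalised Casimir computation: a symmetric biderivation composed with a Casimir operator
is of the form `(x, y) ↦ x (y w)`. -/
lemma exists_operator_apply_eq (h : IsCasimirPair K a b) (f : s →ₗ[K] s →ₗ[K] V)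
    (hf : ∀ x y z, f ⁅x, y⁆ z = ⁅x, f y z⁆ - ⁅y, f x z⁆) (hsymm : ∀ x y, f x y = f y x)
    (h2 : (2 : K) ≠ 0) : ∃ w : V, ∀ x y, h.operator V (f x y) = ⁅x, ⁅y, w⁆⁆ := by
  have hS (y : s) : ∑ i, ⁅a i, f (b i) y⁆ = ⁅y, ∑ i, f (a i) (b i)⁆ := by
    -- Invariance moves `y` from `a i` to `b i` at the cost of a sign; the symmetries of `f` and of
    -- the tensor move it back without one.
    have h1 : ∑ i, f ⁅y, a i⁆ (b i) = 0 := by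
      have e1 := h.sum_lie_left f y
      have e2 := h.sum_comm (f ∘ₗ LieModule.toEnd K s s y)
      simp only [LinearMap.comp_apply, LieModule.toEnd_apply_apply] at e2
      have e3 : ∑ i, f (a i) ⁅y, b i⁆ = ∑ i, f ⁅y, b i⁆ (a i) :=
        Finset.sum_congr rfl fun i _ ↦ hsymm _ _
      rw [e3, ← e2, eq_neg_iff_add_eq_zero, ← two_smul K] at e1
      exact (smul_eq_zero.mp e1).resolve_left h2
    rw [lie_sum, ← sub_eq_zero, ← neg_eq_zero, ← Finset.sum_sub_distrib,
      ← Finset.sum_neg_distrib, ← h1]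
    refine Finset.sum_congr rfl fun i _ ↦ ?_
    rw [hf, hsymm (b i) y, neg_sub]
  -- With this `w`, `hS` reads `y w = ∑ a i · f (b i) y`; applying `x` and using invariance again
  -- produces `∑ a i · (b i · f x y)`.
  refine ⟨∑ i, f (a i) (b i), fun x y ↦ ?_⟩
  rw [← hS, operator_apply, lie_sum, ← sub_eq_zero, ← Finset.sum_sub_distrib]
  have h1 := h.sum_lie_left (V := V) (LinearMap.mk₂ K (fun u v : s ↦ ⁅u, f v y⁆)
      (by simp) (by simp) (by simp) (by simp)) x
  simp only [LinearMap.mk₂_apply] at h1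
  rw [eq_neg_iff_add_eq_zero, ← Finset.sum_add_distrib, ← neg_eq_zero,
    ← Finset.sum_neg_distrib] at h1
  rw [← h1]
  refine Finset.sum_congr rfl fun i _ ↦ ?_
  rw [leibniz_lie x (a i), hf, lie_sub]
  abel

end IsCasimirPair

lemma linearMap_eq_zero_of_lie {I : LieIdeal K s} {U : Type*} [AddCommGroup U] [Module K U]
    (g : s →ₗ[K] U) (hI : ⁅I, I⁆ = I) (hg : ∀ x ∈ I, ∀ y ∈ I, g ⁅x, y⁆ = 0) {x : s}
    (hx : x ∈ I) : g x = 0 := by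
  rw [← hI, ← LieSubmodule.mem_toSubmodule, LieSubmodule.lieIdeal_oper_eq_linear_span'] at hx
  refine Submodule.span_le (p := LinearMap.ker g).mpr ?_ hx
  rintro _ ⟨y, hy, z, hz, rfl⟩
  exact hg y hy z hz

section TrivialRadical

variable [CharZero K] [FiniteDimensional K s] [HasTrivialRadical K s] [FiniteDimensional K V]

/-- The common kernel of all Casimir operators is a submodule; were it nontrivial, some Casimir
operator would have nonzero trace on it. -/
lemma mem_maxTrivSubmodule_of_operator_eq_zero {v : V}
    (hv : ∀ (n : ℕ) (a b : Fin n → s) (h : IsCasimirPair K a b), h.operator V v = 0) :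
    v ∈ LieModule.maxTrivSubmodule K s V := by
  let W : LieSubmodule K s V :=
    { carrier := {v | ∀ (n : ℕ) (a b : Fin n → s) (h : IsCasimirPair K a b), h.operator V v = 0}
      add_mem' := fun hx hy n a b h ↦ by rw [map_add, hx, hy, add_zero]
      zero_mem' := fun n a b h ↦ map_zero _
      smul_mem' := fun c x hx n a b h ↦ by rw [map_smul, hx, smul_zero]
      lie_mem := fun hx n a b h ↦ by rw [LieModuleHom.map_lie, hx, lie_zero] }
  have hW : LieModule.IsTrivial s W := by
    by_contra hW
    obtain ⟨n, a, b, h, htr⟩ := exists_isCasimirPair (K := K) hW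
    refine htr ?_
    convert map_zero (LinearMap.trace K W)
    ext w
    have := w.2 n a b h
    rw [IsCasimirPair.operator_apply] at this
    simpa using this
  intro x
  exact congrArg Subtype.val (hW.trivial x ⟨v, hv⟩)

lemma biderivation_eq_zero_of_symm (f : s →ₗ[K] s →ₗ[K] V)
    (hf : ∀ x y z, f ⁅x, y⁆ z = ⁅x, f y z⁆ - ⁅y, f x z⁆) (hsymm : ∀ x y, f x y = f y x) :
    f = 0 := by
  have hmem (x y : s) : f x y ∈ LieModule.maxTrivSubmodule K s V := by
    refine mem_maxTrivSubmodule_of_operator_eq_zero fun n a b h ↦ ?_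
    obtain ⟨w, hw⟩ := h.exists_operator_apply_eq f hf hsymm two_ne_zero
    -- `[x,y] w = x(y w) - y(x w) = Ω f(x,y) - Ω f(y,x) = 0`, and `s` is spanned by brackets.
    have h1 : ⁅y, w⁆ = 0 := by
      refine linearMap_eq_zero_of_lie ((LinearMap.mk₂ K (fun (x : s) (v : V) ↦ ⁅x, v⁆)
        (by simp) (by simp) (by simp) (by simp)).flip w)
        (lieIdeal_lie_self_eq (K := K) ⊤) (fun x _ y _ ↦ ?_) (LieSubmodule.mem_top y)
      change ⁅⁅x, y⁆, w⁆ = 0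
      rw [lie_lie, ← hw, ← hw, hsymm, sub_self]
    rw [hw, h1, lie_zero]
  ext1 x
  refine linearMap_eq_zero_of_lie f (lieIdeal_lie_self_eq (K := K) ⊤) (fun x _ y _ ↦ ?_)
    (LieSubmodule.mem_top x)
  ext z
  rw [hf, hmem y z x, hmem x z y, sub_zero, LinearMap.zero_apply]

/-- Induction on `dim V` through the Fitting decomposition of a Casimir operator `Ω` of nonzero
trace. Its image part lies in `sV`, its null part contains all invariants, and the null part is
proper since `Ω` is not nilpotent. Complete reducibility is not needed. -/
theorem isCompl_lie_top_maxTrivSubmodule (s : Type*) [LieRing s] [LieAlgebra K s]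
    [FiniteDimensional K s] [HasTrivialRadical K s] (V : Type*) [AddCommGroup V] [Module K V]
    [LieRingModule s V] [LieModule K s V] [FiniteDimensional K V] :
    IsCompl ⁅(⊤ : LieIdeal K s), (⊤ : LieSubmodule K s V)⁆ (LieModule.maxTrivSubmodule K s V) := by
  induction hd : Module.finrank K V using Nat.strong_induction_on generalizing V with
  | _ d ih =>
  by_cases hV : LieModule.IsTrivial s V
  · have h := (LieModule.isTrivial_iff_max_triv_eq_top K s V).mp hV
    have h' : ⁅(⊤ : LieIdeal K s), (⊤ : LieSubmodule K s V)⁆ = ⊥ := by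
      simp
    rw [h, h']
    exact isCompl_bot_top
  obtain ⟨m, a, b, h, htr⟩ := exists_isCasimirPair (K := K) hV
  let Ω : V →ₗ[K] V := (h.operator V : V →ₗ[K] V)
  have hΩ : LinearMap.trace K V Ω ≠ 0 := htr
  have hΩlie (v : V) : Ω v ∈ ⁅(⊤ : LieIdeal K s), (⊤ : LieSubmodule K s V)⁆ := by
    change h.operator V v ∈ _
    rw [h.operator_apply]
    exact sum_mem fun i _ ↦ LieSubmodule.lie_mem_lie (LieSubmodule.mem_top _)
      (LieSubmodule.mem_top _)
  obtain ⟨n, hn, hn1⟩ := (Ω.eventually_isCompl_ker_pow_range_pow.and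
    (Filter.eventually_ge_atTop 1)).exists
  -- A positive exponent is needed for the range of the power to lie in `sV` and for its kernel to
  -- contain the invariants.
  obtain ⟨n, rfl⟩ : ∃ l, n = l + 1 := ⟨n - 1, by omega⟩
  have hpow (l : ℕ) (x : s) (v : V) : (Ω ^ l) ⁅x, v⁆ = ⁅x, (Ω ^ l) v⁆ := by
    induction l with
    | zero => rfl
    | succ l ihl =>
      rw [pow_succ', Module.End.mul_apply, ihl, Module.End.mul_apply]
      exact LieModuleHom.map_lie (h.operator V) _ _
  let A : LieSubmodule K s V :=
    { LinearMap.ker (Ω ^ (n + 1)) with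
      lie_mem := fun {x v} hv ↦ by
        have hv : (Ω ^ (n + 1)) v = 0 := hv
        change (Ω ^ (n + 1)) _ = 0
        rw [hpow, hv, lie_zero] }
  let R : LieSubmodule K s V :=
    { LinearMap.range (Ω ^ (n + 1)) with
      lie_mem := by
        rintro x _ ⟨v, rfl⟩
        exact ⟨⁅x, v⁆, hpow _ x v⟩ }
  have hAR : IsCompl A R := LieSubmodule.isCompl_toSubmodule.mp hn
  have hA : Module.finrank K A < d := by
    rw [← hd]
    refine Submodule.finrank_lt (s := A.toSubmodule) (fun hA ↦ hΩ ?_)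
    refine (LinearMap.isNilpotent_trace_of_isNilpotent ⟨n + 1, ?_⟩).eq_zero
    exact LinearMap.ker_eq_top.mp hA
  have ihA := ih _ hA A rfl
  have hmap : LieSubmodule.map A.incl ⁅(⊤ : LieIdeal K s), (⊤ : LieSubmodule K s A)⁆ =
      ⁅(⊤ : LieIdeal K s), A⁆ := by
    rw [LieSubmodule.map_bracket_eq]
    simp
  have htriv : LieSubmodule.map A.incl (LieModule.maxTrivSubmodule K s A) ≤
      LieModule.maxTrivSubmodule K s V := by
    rintro _ ⟨v, hv, rfl⟩ x
    exact congrArg Subtype.val (hv x)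
  have hR : R ≤ ⁅(⊤ : LieIdeal K s), (⊤ : LieSubmodule K s V)⁆ := by
    rintro _ ⟨v, rfl⟩
    rw [pow_succ', Module.End.mul_apply]
    exact hΩlie _
  have hA' : A ≤ ⁅(⊤ : LieIdeal K s), (⊤ : LieSubmodule K s V)⁆ ⊔
      LieModule.maxTrivSubmodule K s V := by
    have := congrArg (LieSubmodule.map A.incl) ihA.sup_eq_top
    rw [LieSubmodule.map_sup, hmap] at this
    have e : LieSubmodule.map A.incl ⊤ = A := by simp
    rw [e] at this
    rw [← this]
    exact sup_le_sup (LieSubmodule.mono_lie_right _ le_top) htriv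
  refine ⟨?_, ?_⟩
  · rw [disjoint_iff, LieSubmodule.eq_bot_iff]
    rintro v ⟨hv, hvt⟩
    have hvA : v ∈ A := by
      change (Ω ^ (n + 1)) v = 0
      rw [pow_succ, Module.End.mul_apply]
      have : Ω v = 0 := by
        change h.operator V v = 0
        rw [h.operator_apply]
        exact Finset.sum_eq_zero fun i _ ↦ by rw [hvt, lie_zero]
      rw [this, map_zero]
    rw [← hAR.sup_eq_top, LieSubmodule.lie_sup] at hv
    obtain ⟨p, hp, r, hr, rfl⟩ := (LieSubmodule.mem_sup _ _ _).mp hv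
    have hpA : p ∈ A := LieSubmodule.lie_le_right A ⊤ hp
    have hrR : r ∈ R := LieSubmodule.lie_le_right R ⊤ hr
    have hrA : r ∈ A := by simpa using sub_mem hvA hpA
    have hr0 : r ∈ A ⊓ R := ⟨hrA, hrR⟩
    rw [hAR.inf_eq_bot, LieSubmodule.mem_bot] at hr0
    subst hr0
    rw [add_zero] at hvt ⊢
    rw [← hmap] at hp
    obtain ⟨q, hq, rfl⟩ := hp
    have hqt : q ∈ LieModule.maxTrivSubmodule K s A := fun x ↦ Subtype.ext (hvt x)
    have : q ∈ (⊥ : LieSubmodule K s A) := ihA.inf_eq_bot ▸ ⟨hq, hqt⟩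
    rw [(LieSubmodule.mem_bot q).mp this, map_zero]
  · rw [codisjoint_iff, eq_top_iff]
    refine hAR.sup_eq_top.symm.le.trans ?_
    exact sup_le hA' (hR.trans le_sup_left)

end TrivialRadical

end LieAlgebra

/-! ### Reductive Lie algebras: derived algebra and centre -/

namespace LieAlgebra

section Reductive

attribute [local instance] LieRing.ofAssociativeRing

variable {K k : Type*} [Field K] [LieRing k] [LieAlgebra K k]

lemma rangeRestrict_ad_eq_zero_iff (x : k) :
    (ad K k).rangeRestrict x = 0 ↔ x ∈ center K k := by
  rw [← self_module_ker_eq_center, LieModule.mem_ker, Subtype.ext_iff, LinearMap.ext_iff]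
  rfl

/-- An abelian ideal of `ad k` pulls back to an ideal `J` with `[J,J]` central; `J` is then
solvable, hence central, and its image is zero. -/
lemma hasTrivialRadical_range_ad [FiniteDimensional K k] (h : radical K k = center K k) :
    HasTrivialRadical K (ad K k).range := by
  refine (hasTrivialRadical_iff_no_abelian_ideals K _).mpr fun I hI ↦ ?_
  let φ : k →ₗ⁅K⁆ (ad K k).range := (ad K k).rangeRestrict
  have hφ (x : k) : φ x = 0 ↔ x ∈ center K k := rangeRestrict_ad_eq_zero_iff x
  let J : LieIdeal K k := I.comap φ
  have hJJ : ⁅J, J⁆ ≤ center K k := by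
    rw [LieSubmodule.lie_le_iff]
    intro x hx y hy
    rw [← hφ, LieHom.map_lie]
    have hx' : φ x ∈ I := hx
    have hy' : φ y ∈ I := hy
    exact congrArg Subtype.val (hI.trivial ⟨φ x, hx'⟩ ⟨φ y, hy'⟩)
  have hsolv : IsSolvable J := by
    refine IsSolvable.mk (R := K) (k := 2) ?_
    rw [LieIdeal.derivedSeries_eq_bot_iff]
    simp only [derivedSeriesOfIdeal_succ, derivedSeriesOfIdeal_zero]
    rw [LieSubmodule.lie_eq_bot_iff]
    intro x hx y hy
    exact hJJ hy x
  have hJ : J ≤ center K k := h ▸ (LieIdeal.solvable_iff_le_radical K k J).mp hsolv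
  rw [LieSubmodule.eq_bot_iff]
  intro x hx
  obtain ⟨y, rfl⟩ := (ad K k).surjective_rangeRestrict x
  exact (hφ y).mpr (hJ hx)

variable [CharZero K] [FiniteDimensional K k]

/-- This is `V = sV ⊕ Vˢ` for `V = k` as a module over the semisimple algebra `ad k`. -/
lemma isCompl_derived_center (h : radical K k = center K k) :
    IsCompl ⁅(⊤ : LieIdeal K k), (⊤ : LieIdeal K k)⁆ (center K k) := by
  have := hasTrivialRadical_range_ad h
  have hc := isCompl_lie_top_maxTrivSubmodule (K := K) (ad K k).range k
  rw [← LieSubmodule.isCompl_toSubmodule] at hc ⊢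
  convert hc using 1
  · rw [LieSubmodule.lieIdeal_oper_eq_linear_span', LieSubmodule.lieIdeal_oper_eq_linear_span']
    congr 1
    ext z
    constructor
    · rintro ⟨x, -, y, -, rfl⟩
      exact ⟨(ad K k).rangeRestrict x, trivial, y, trivial, rfl⟩
    · rintro ⟨x, -, y, -, rfl⟩
      obtain ⟨x, rfl⟩ := (ad K k).surjective_rangeRestrict x
      exact ⟨x, trivial, y, trivial, rfl⟩
  · ext z
    constructor
    · intro hz x
      obtain ⟨x, rfl⟩ := (ad K k).surjective_rangeRestrict x
      exact hz x
    · exact fun hz x ↦ hz ((ad K k).rangeRestrict x)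

lemma hasTrivialRadical_derived (h : radical K k = center K k) :
    HasTrivialRadical K (⁅(⊤ : LieIdeal K k), (⊤ : LieIdeal K k)⁆ : LieIdeal K k) := by
  have := hasTrivialRadical_range_ad h
  have hc := isCompl_derived_center h
  set D : LieIdeal K k := ⁅(⊤ : LieIdeal K k), (⊤ : LieIdeal K k)⁆
  let φ : D →ₗ⁅K⁆ (ad K k).range := (ad K k).rangeRestrict.comp D.incl
  have hφ (x : k) := rangeRestrict_ad_eq_zero_iff (K := K) x
  have hbij : Function.Bijective φ := by
    constructor
    · rw [injective_iff_map_eq_zero]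
      intro x hx
      have h1 : (x : k) ∈ D ⊓ center K k := ⟨x.2, (hφ x).mp hx⟩
      rw [hc.inf_eq_bot, LieSubmodule.mem_bot] at h1
      exact Subtype.ext h1
    · intro y
      obtain ⟨x, rfl⟩ := (ad K k).surjective_rangeRestrict y
      obtain ⟨d, hd, c, hcm, rfl⟩ :=
        (LieSubmodule.mem_sup _ _ _).mp (hc.sup_eq_top ▸ LieSubmodule.mem_top x)
      refine ⟨⟨d, hd⟩, ?_⟩
      rw [map_add, (hφ c).mpr hcm, add_zero]
      rfl
  have := LieAlgebra.isKilling_of_equiv (LieEquiv.ofBijective φ hbij).symm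
  infer_instance

end Reductive

end LieAlgebra

/-! ### Super-biderivations and the action of the derived even part -/

namespace LieSuperalgebra

variable {L : Type*} [AddCommGroup L] [Module ℂ L] [LieSuperalgebra L]

lemma eq_zero_of_eq_neg {V : Type*} [AddCommGroup V] [Module ℂ V] {v : V} (h : v = -v) :
    v = 0 := by
  rw [eq_neg_iff_add_eq_zero, ← two_smul ℂ] at h
  exact (smul_eq_zero.mp h).resolve_left two_ne_zero

variable (L) in
/-- The bracket of a Lie superalgebra as a bilinear map. -/
def bracketHom : L →ₗ[ℂ] L →ₗ[ℂ] L :=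
  LinearMap.mk₂ ℂ (fun x y ↦ ⁅x, y⁆) add_bracket smul_bracket bracket_add bracket_smul

lemma bracket_zero (x : L) : ⁅x, (0 : L)⁆ = 0 := map_zero (bracketHom L x)

lemma zero_bracket (x : L) : ⁅(0 : L), x⁆ = 0 := LinearMap.map_zero₂ (bracketHom L) x

lemma bracket_sub (x y z : L) : ⁅x, y - z⁆ = ⁅x, y⁆ - ⁅x, z⁆ := map_sub (bracketHom L x) y z

lemma exists_even_add_odd (x : L) : ∃ a ∈ even L, ∃ b ∈ odd L, a + b = x :=
  Submodule.mem_sup.mp ((isCompl_grade (L := L)).sup_eq_top ▸ Submodule.mem_top)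

lemma homogeneous_induction {p : L → Prop} (h : ∀ i, ∀ x ∈ grade i, p x)
    (hadd : ∀ x y, p x → p y → p (x + y)) (x : L) : p x := by
  obtain ⟨a, ha, b, hb, rfl⟩ := exists_even_add_odd x
  exact hadd _ _ (h 0 a ha) (h 1 b hb)

lemma even_jacobi {x : L} (hx : x ∈ even L) (y z : L) :
    ⁅x, ⁅y, z⁆⁆ = ⁅⁅x, y⁆, z⁆ + ⁅y, ⁅x, z⁆⁆ := by
  induction y using homogeneous_induction with
  | h j y hy =>
    induction z using homogeneous_induction with
    | h k z hz => simpa using super_jacobi hx hy hz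
    | hadd z z' h h' => simp only [bracket_add, h, h']; abel
  | hadd y y' h h' => simp only [bracket_add, add_bracket, h, h']; abel

instance : LieRingModule (even L) L where
  bracket x v := ⁅(x : L), v⁆
  add_lie x y v := add_bracket (x : L) y v
  lie_add x v w := bracket_add (x : L) v w
  leibniz_lie x y v := even_jacobi x.2 (y : L) v

instance : LieModule ℂ (even L) L where
  smul_lie c x v := smul_bracket c (x : L) v
  lie_smul c x v := bracket_smul c (x : L) v

lemma coe_derivedEven_lie (x y : derivedEven L) :
    ((⁅x, y⁆ : derivedEven L) : L) = ⁅((x : even L) : L), ((y : even L) : L)⁆ := rfl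

section Biderivation

variable {d : ZMod 2} {δ : L →ₗ[ℂ] L →ₗ[ℂ] L}

lemma IsSuperBiderivation.apply_even_lie_even (hδ : IsSuperBiderivation d δ) {x y : L}
    (hx : x ∈ even L) (hy : y ∈ even L) (z : L) : δ ⁅x, y⁆ z = ⁅x, δ y z⁆ - ⁅y, δ x z⁆ := by
  induction z using homogeneous_induction with
  | h k z hz => simpa using hδ.left_derivation hx hy hz
  | hadd z z' h h' => simp only [map_add, bracket_add, h, h']; abel

lemma IsSuperSymmetric.apply_even (hsymm : IsSuperSymmetric δ) {x : L} (hx : x ∈ even L) (y : L) :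
    δ x y = δ y x := by
  induction y using homogeneous_induction with
  | h k y hy => simpa using hsymm hx hy
  | hadd y y' h h' => simp only [map_add, LinearMap.add_apply, h, h']

lemma IsSuperSymmetric.apply_odd (hsymm : IsSuperSymmetric δ) {x : L} (hx : x ∈ odd L) :
    δ x x = 0 := by
  have h := hsymm hx hx
  exact eq_zero_of_eq_neg (by simpa using h)

lemma derivedEven_perfect_eq_zero [FiniteDimensional ℂ L]
    [LieAlgebra.HasTrivialRadical ℂ (derivedEven L)] {U : Type*} [AddCommGroup U] [Module ℂ U]
    (g : L →ₗ[ℂ] U) (hg : ∀ x y : derivedEven L, g ⁅((x : even L) : L), ((y : even L) : L)⁆ = 0)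
    (x : derivedEven L) : g ((x : even L) : L) = 0 :=
  LieAlgebra.linearMap_eq_zero_of_lie (K := ℂ)
    (g ∘ₗ (even L).subtype ∘ₗ (derivedEven L).toSubmodule.subtype : derivedEven L →ₗ[ℂ] U)
    (LieAlgebra.lieIdeal_lie_self_eq (K := ℂ) (⊤ : LieIdeal ℂ (derivedEven L)))
    (fun x _ y _ ↦ hg x y) (LieSubmodule.mem_top x)

variable [FiniteDimensional ℂ L] [LieAlgebra.HasTrivialRadical ℂ (derivedEven L)]
  (hδ : IsSuperBiderivation d δ) (hsymm : IsSuperSymmetric δ)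

include hδ hsymm

lemma apply_derivedEven_derivedEven (x y : derivedEven L) :
    δ ((x : even L) : L) ((y : even L) : L) = 0 := by
  let ι : derivedEven L →ₗ[ℂ] L := (even L).subtype ∘ₗ (derivedEven L).toSubmodule.subtype
  have h : δ.compl₁₂ ι ι = 0 := LieAlgebra.biderivation_eq_zero_of_symm _
    (fun x y z ↦ hδ.apply_even_lie_even (x : even L).2 (y : even L).2 _)
    (fun x y ↦ hsymm.apply_even (x : even L).2 _)
  exact LinearMap.congr_fun₂ h x y

/-- The expression `[[z,x], δ(y,v)]` is antisymmetric in `z, x` and symmetric in `x, y`, so it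
vanishes; perfectness then removes first the inner bracket and then `δ(y,v)` itself. -/
lemma apply_derivedEven (x : derivedEven L) (v : L) : δ ((x : even L) : L) v = 0 := by
  have h1 (x y : derivedEven L) (v : L) :
      δ ((x : even L) : L) ⁅((y : even L) : L), v⁆ = ⁅((y : even L) : L), δ x v⁆ := by
    induction v using homogeneous_induction with
    | h k v hv =>
      simpa [apply_derivedEven_derivedEven hδ hsymm, bracket_zero] using
        hδ.right_derivation (x : even L).2 (y : even L).2 hv
    | hadd v v' h h' => simp only [map_add, bracket_add, h, h']
  have h2 (x y : derivedEven L) (v : L) := hδ.apply_even_lie_even (x : even L).2 (y : even L).2 v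
  let g (z x y : derivedEven L) : L :=
    ⁅⁅((z : even L) : L), ((x : even L) : L)⁆, δ ((y : even L) : L) v⁆
  have hj (x y : derivedEven L) (w : L) := even_jacobi (x : even L).2 ((y : even L) : L) w
  have ga (z x y) : g z x y = - g x z y := by
    simp only [g]
    rw [← sub_eq_iff_eq_add.mpr (hj z x _), ← sub_eq_iff_eq_add.mpr (hj x z _), neg_sub]
  have gs (z x y) : g z x y = g z y x := by
    -- `δ([x,y],[z,v])` is expanded in two ways: with `h1` first or with the left derivation rule
    -- first.
    have e1 := h1 ⁅x, y⁆ z v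
    rw [coe_derivedEven_lie, h2, h2, h1, h1, bracket_sub, hj z x, hj z y] at e1
    simp only [g]
    rw [← sub_eq_zero, ← sub_eq_zero.mpr e1.symm]
    abel
  have g0 (z x y) : g z x y = 0 := by
    have e : g z x y = - g z x y := by
      conv_lhs => rw [ga, gs, ga, gs, ga, gs, neg_neg]
    exact eq_zero_of_eq_neg e
  have g1 (z y : derivedEven L) : ⁅((z : even L) : L), δ y v⁆ = 0 :=
    derivedEven_perfect_eq_zero ((bracketHom L).flip (δ y v)) (fun z x ↦ g0 z x y) z
  refine derivedEven_perfect_eq_zero (δ.flip v) (fun x y ↦ ?_) x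
  rw [LinearMap.flip_apply, h2, g1, g1, sub_zero]

lemma apply_lie_left (x : derivedEven L) (v w : L) :
    δ ⁅((x : even L) : L), v⁆ w = ⁅((x : even L) : L), δ v w⁆ := by
  induction v using homogeneous_induction with
  | h j v hv =>
    induction w using homogeneous_induction with
    | h k w hw =>
      simpa [apply_derivedEven hδ hsymm, bracket_zero] using
        hδ.left_derivation (x : even L).2 hv hw
    | hadd w w' h h' => simp only [map_add, bracket_add, h, h']
  | hadd v v' h h' => simp only [map_add, bracket_add, LinearMap.add_apply, h, h']

lemma apply_lie_right (x : derivedEven L) (v w : L) :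
    δ v ⁅((x : even L) : L), w⁆ = ⁅((x : even L) : L), δ v w⁆ := by
  induction v using homogeneous_induction with
  | h j v hv =>
    induction w using homogeneous_induction with
    | h k w hw =>
      simpa [← hsymm.apply_even (x : even L).2, apply_derivedEven hδ hsymm, bracket_zero] using
        hδ.right_derivation hv (x : even L).2 hw
    | hadd w w' h h' => simp only [map_add, bracket_add, h, h']
  | hadd v v' h h' => simp only [map_add, bracket_add, LinearMap.add_apply, h, h']

/-- Both `x(y δ(v,w))` and `y(x δ(v,w))` equal `δ(xv, yw)`, so every bracket `[x,y]` kills `δ(v,w)`.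
-/
lemma derivedEven_lie_apply (x : derivedEven L) (v w : L) : ⁅((x : even L) : L), δ v w⁆ = 0 := by
  refine derivedEven_perfect_eq_zero ((bracketHom L).flip (δ v w)) (fun x y ↦ ?_) x
  change ⁅⁅((x : even L) : L), ((y : even L) : L)⁆, δ v w⁆ = 0
  rw [← sub_eq_iff_eq_add.mpr (even_jacobi (x : even L).2 _ _), ← apply_lie_right hδ hsymm y,
    ← apply_lie_left hδ hsymm x, apply_lie_right hδ hsymm y, apply_lie_left hδ hsymm x, sub_self]

end Biderivation

end LieSuperalgebra

/-! ### The decomposition `L = [s,L] ⊕ Lˢ` and its odd part -/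

namespace LieSuperalgebra

section Decomposition

variable {L : Type*} [AddCommGroup L] [Module ℂ L] [LieSuperalgebra L]

lemma eq_of_even_add_odd_eq {a a' b b' : L} (ha : a ∈ even L) (ha' : a' ∈ even L) (hb : b ∈ odd L)
    (hb' : b' ∈ odd L) (h : a + b = a' + b') : a = a' ∧ b = b' := by
  have h1 : a - a' = b' - b := by rw [sub_eq_sub_iff_add_eq_add, h, add_comm]
  have h2 : a - a' = 0 := Submodule.disjoint_def.mp (isCompl_grade (L := L)).disjoint _
    (sub_mem ha ha') (h1 ▸ sub_mem hb' hb)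
  exact ⟨sub_eq_zero.mp h2, (sub_eq_zero.mp (h1 ▸ h2)).symm⟩

lemma even_bracket_even {x y : L} (hx : x ∈ even L) (hy : y ∈ even L) : ⁅x, y⁆ ∈ even L := by
  simpa using bracket_mem hx hy

lemma even_bracket_odd {x y : L} (hx : x ∈ even L) (hy : y ∈ odd L) : ⁅x, y⁆ ∈ odd L := by
  simpa using bracket_mem hx hy

lemma odd_bracket_odd {x y : L} (hx : x ∈ odd L) (hy : y ∈ odd L) : ⁅x, y⁆ ∈ even L :=
  bracket_mem hx hy

lemma odd_bracket_comm {x y : L} (hx : x ∈ odd L) (hy : y ∈ odd L) : ⁅x, y⁆ = ⁅y, x⁆ := by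
  simpa using super_skew hx hy

lemma bracket_even_eq_neg {x y : L} (hx : x ∈ odd L) (hy : y ∈ even L) : ⁅x, y⁆ = -⁅y, x⁆ := by
  simpa using super_skew hx hy

variable (L) in
/-- The span `[[L₀, L₀], L]`. -/
def derivedEvenBracket : Submodule ℂ L :=
  Submodule.span ℂ {z | ∃ (x : derivedEven L) (v : L), ⁅((x : even L) : L), v⁆ = z}

lemma lie_mem_derivedEvenBracket (x : derivedEven L) (v : L) :
    ⁅((x : even L) : L), v⁆ ∈ derivedEvenBracket L :=
  Submodule.subset_span ⟨x, v, rfl⟩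

variable (L) in
/-- The centraliser of `[L₀, L₀]` in `L`. -/
def invariants : Submodule ℂ L :=
  (LieModule.maxTrivSubmodule ℂ (derivedEven L) L).toSubmodule

lemma mem_invariants {v : L} :
    v ∈ invariants L ↔ ∀ x : derivedEven L, ⁅((x : even L) : L), v⁆ = 0 := Iff.rfl

lemma mem_oddInvariants {v : L} : v ∈ oddInvariants L ↔ v ∈ odd L ∧ v ∈ invariants L :=
  and_congr_right fun _ ↦ ⟨fun h x ↦ h x x.2, fun h x hx ↦ h ⟨x, hx⟩⟩

lemma isCompl_derivedEvenBracket_invariants [FiniteDimensional ℂ L]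
    [LieAlgebra.HasTrivialRadical ℂ (derivedEven L)] :
    IsCompl (derivedEvenBracket L) (invariants L) := by
  have h := LieAlgebra.isCompl_lie_top_maxTrivSubmodule (K := ℂ) (derivedEven L) L
  rw [← LieSubmodule.isCompl_toSubmodule] at h
  suffices h' : derivedEvenBracket L =
      ⁅(⊤ : LieIdeal ℂ (derivedEven L)), (⊤ : LieSubmodule ℂ (derivedEven L) L)⁆.toSubmodule by
    rw [h']
    exact h
  rw [LieSubmodule.lieIdeal_oper_eq_linear_span', derivedEvenBracket]
  congr 1
  ext z
  exact ⟨fun ⟨x, v, h⟩ ↦ ⟨x, trivial, v, trivial, h⟩, fun ⟨x, _, v, _, h⟩ ↦ ⟨x, v, h⟩⟩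

/-- For invariant `t`, Jacobi gives `[[x,l],t] = [x,[l,t]]`. -/
lemma bracket_mem_derivedEvenBracket {u t : L} (hu : u ∈ derivedEvenBracket L)
    (ht : t ∈ invariants L) : ⁅u, t⁆ ∈ derivedEvenBracket L := by
  refine Submodule.span_le (p := (derivedEvenBracket L).comap ((bracketHom L).flip t)).mpr ?_ hu
  rintro _ ⟨x, l, rfl⟩
  change ⁅⁅((x : even L) : L), l⁆, t⁆ ∈ derivedEvenBracket L
  have h := even_jacobi (x : even L).2 l t
  rw [mem_invariants.mp ht x, bracket_zero, add_zero] at h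
  exact h ▸ lie_mem_derivedEvenBracket _ _

lemma exists_graded_of_mem_derivedEvenBracket {p : L} (hp : p ∈ derivedEvenBracket L) :
    ∃ a ∈ even L, ∃ b ∈ odd L, b ∈ derivedEvenBracket L ∧ a + b = p := by
  induction hp using Submodule.span_induction with
  | mem p h =>
    obtain ⟨x, v, rfl⟩ := h
    obtain ⟨a, ha, b, hb, rfl⟩ := exists_even_add_odd v
    exact ⟨_, even_bracket_even (x : even L).2 ha, _, even_bracket_odd (x : even L).2 hb,
      lie_mem_derivedEvenBracket x b, (bracket_add _ _ _).symm⟩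
  | zero => exact ⟨0, zero_mem _, 0, zero_mem _, zero_mem _, add_zero 0⟩
  | add p q _ _ hp hq =>
    obtain ⟨a, ha, b, hb, hb', rfl⟩ := hp
    obtain ⟨c, hc, e, he, he', rfl⟩ := hq
    exact ⟨_, add_mem ha hc, _, add_mem hb he, add_mem hb' he', add_add_add_comm _ _ _ _⟩
  | smul r p _ hp =>
    obtain ⟨a, ha, b, hb, hb', rfl⟩ := hp
    exact ⟨_, Submodule.smul_mem _ r ha, _, Submodule.smul_mem _ r hb,
      Submodule.smul_mem _ r hb', (smul_add _ _ _).symm⟩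

lemma exists_graded_of_mem_invariants {q : L} (hq : q ∈ invariants L) :
    ∃ a ∈ even L, ∃ b ∈ oddInvariants L, a + b = q := by
  obtain ⟨a, ha, b, hb, rfl⟩ := exists_even_add_odd q
  refine ⟨a, ha, b, mem_oddInvariants.mpr ⟨hb, fun x ↦ ?_⟩, rfl⟩
  have h : ⁅((x : even L) : L), a⁆ + ⁅((x : even L) : L), b⁆ = 0 + 0 := by
    rw [← bracket_add, mem_invariants.mp hq x, add_zero]
  exact (eq_of_even_add_odd_eq (even_bracket_even (x : even L).2 ha) (zero_mem _)
    (even_bracket_odd (x : even L).2 hb) (zero_mem _) h).2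

lemma exists_oddInvariants_add [FiniteDimensional ℂ L]
    [LieAlgebra.HasTrivialRadical ℂ (derivedEven L)] {v : L} (hv : v ∈ odd L) :
    ∃ p ∈ odd L, p ∈ derivedEvenBracket L ∧ ∃ q ∈ oddInvariants L, p + q = v := by
  obtain ⟨p, hp, q, hq, hpq⟩ := Submodule.mem_sup.mp
    (isCompl_derivedEvenBracket_invariants (L := L).sup_eq_top ▸ Submodule.mem_top (x := v))
  obtain ⟨a, ha, b, hb, hb', rfl⟩ := exists_graded_of_mem_derivedEvenBracket hp
  obtain ⟨c, hc, e, he, rfl⟩ := exists_graded_of_mem_invariants hq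
  refine ⟨b, hb, hb', e, he, ?_⟩
  have h : (a + c) + (b + e) = 0 + v := by rw [add_add_add_comm, hpq, zero_add]
  exact (eq_of_even_add_odd_eq (add_mem ha hc) (zero_mem _) (add_mem hb he.1) hv h).2

lemma mem_of_isPerfect (hperf : IsPerfect L) {N : Submodule ℂ L}
    (h00 : ∀ x ∈ even L, ∀ y ∈ even L, ⁅x, y⁆ ∈ N) (h01 : ∀ x ∈ even L, ∀ y ∈ odd L, ⁅x, y⁆ ∈ N)
    (h11 : ∀ x ∈ odd L, ∀ y ∈ odd L, ⁅x, y⁆ ∈ N) (z : L) : z ∈ N := by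
  have hz : z ∈ Submodule.span ℂ {z : L | ∃ x y : L, ⁅x, y⁆ = z} := hperf ▸ Submodule.mem_top
  refine Submodule.span_le.mpr ?_ hz
  rintro _ ⟨x, y, rfl⟩
  obtain ⟨a, ha, b, hb, rfl⟩ := exists_even_add_odd x
  obtain ⟨c, hc, e, he, rfl⟩ := exists_even_add_odd y
  rw [SetLike.mem_coe, add_bracket, bracket_add, bracket_add, bracket_even_eq_neg hb hc]
  exact add_mem (add_mem (h00 a ha c hc) (h01 a ha e he))
    (add_mem (neg_mem (h01 c hc b hb)) (h11 b hb e he))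

lemma exists_derivedEven_add_center [FiniteDimensional ℂ L]
    (hred : IsReductiveLieAlgebra (even L)) {a : L} (ha : a ∈ even L) :
    ∃ (x : derivedEven L) (c : L), c ∈ even L ∧ (∀ y ∈ even L, ⁅y, c⁆ = 0) ∧
      ((x : even L) : L) + c = a := by
  have h := LieAlgebra.isCompl_derived_center hred
  obtain ⟨x, hx, c, hc, hxc⟩ := (LieSubmodule.mem_sup _ _ _).mp
    (h.sup_eq_top ▸ LieSubmodule.mem_top (⟨a, ha⟩ : even L))
  exact ⟨⟨x, hx⟩, c, c.2, fun y hy ↦ congrArg Subtype.val (hc ⟨y, hy⟩), congrArg Subtype.val hxc⟩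

lemma even_bracket_comm_of_eq_zero {x y : L} (hx : x ∈ even L) (hy : y ∈ even L)
    (h : ⁅x, y⁆ = 0) : ⁅y, x⁆ = 0 := by
  simpa [h] using super_skew hy hx

/-- If `[L₀, L₀]` has at most a line of odd invariants, that line squares to zero. -/
lemma bracket_self_eq_zero_of_oddInvariants [FiniteDimensional ℂ L]
    [LieAlgebra.HasTrivialRadical ℂ (derivedEven L)] (hperf : IsPerfect L)
    (hred : IsReductiveLieAlgebra (even L)) {v : L} (hv : v ∈ oddInvariants L)
    (hspan : ∀ w ∈ oddInvariants L, ∃ r : ℂ, r • v = w) : ⁅v, v⁆ = 0 := by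
  have hvi := (mem_oddInvariants.mp hv).2
  by_cases hex : ∃ c ∈ even L, (∀ y ∈ even L, ⁅y, c⁆ = 0) ∧ ⁅c, v⁆ ≠ 0
  -- Here a central even `c` scales `v` by some `r ≠ 0`, so `0 = [c,[v,v]] = 2r[v,v]`.
  · obtain ⟨c, hc, hcc, hcv⟩ := hex
    have hmem : ⁅c, v⁆ ∈ oddInvariants L := by
      refine mem_oddInvariants.mpr ⟨even_bracket_odd hc hv.1, fun x ↦ ?_⟩
      have h := even_jacobi (x : even L).2 c v
      rwa [hcc _ (x : even L).2, zero_bracket, mem_invariants.mp hvi x, bracket_zero,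
        add_zero] at h
    obtain ⟨r, hr⟩ := hspan _ hmem
    have hr0 : r ≠ 0 := by
      rintro rfl
      exact hcv (by rw [← hr, zero_smul])
    have hvv := odd_bracket_odd hv.1 hv.1
    have h := even_jacobi hc v v
    rw [even_bracket_comm_of_eq_zero hvv hc (hcc _ hvv), ← hr, smul_bracket, bracket_smul,
      ← smul_add, ← two_smul ℂ ⁅v, v⁆] at h
    exact (smul_eq_zero.mp ((smul_eq_zero.mp h.symm).resolve_left hr0)).resolve_left two_ne_zero
  -- Here the centre of the even part kills `v`, so every bracket lies in `even L + [s,L]`. By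
  -- perfectness `v` lies there too, hence in `[s,L] ∩ Lˢ = 0`.
  · push Not at hex
    have htop := mem_of_isPerfect hperf (N := even L ⊔ derivedEvenBracket L)
      (fun x hx y hy ↦ Submodule.mem_sup_left (even_bracket_even hx hy))
      (fun a ha b hb ↦ Submodule.mem_sup_right ?_)
      (fun x hx y hy ↦ Submodule.mem_sup_left (odd_bracket_odd hx hy)) v
    · obtain ⟨e, he, p, hp, hep⟩ := Submodule.mem_sup.mp htop
      obtain ⟨a, ha, b, hb, hb', rfl⟩ := exists_graded_of_mem_derivedEvenBracket hp
      have h : (e + a) + b = 0 + v := by rw [add_assoc, hep, zero_add]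
      obtain rfl := (eq_of_even_add_odd_eq (add_mem he ha) (zero_mem _) hb hv.1 h).2
      rw [Submodule.disjoint_def.mp isCompl_derivedEvenBracket_invariants.disjoint b hb' hvi,
        bracket_zero]
    · obtain ⟨x, c, hc, hcc, rfl⟩ := exists_derivedEven_add_center hred ha
      rw [add_bracket]
      refine add_mem (lie_mem_derivedEvenBracket x b) ?_
      obtain ⟨p, -, hp, q, hq, rfl⟩ := exists_oddInvariants_add hb
      obtain ⟨r, rfl⟩ := hspan q hq
      rw [bracket_add, bracket_smul, hex c hc hcc, smul_zero, add_zero]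
      refine Submodule.span_le (p := (derivedEvenBracket L).comap (bracketHom L c)).mpr ?_ hp
      rintro _ ⟨y, l, rfl⟩
      change ⁅c, ⁅((y : even L) : L), l⁆⁆ ∈ derivedEvenBracket L
      rw [even_jacobi hc, even_bracket_comm_of_eq_zero (y : even L).2 hc (hcc _ (y : even L).2),
        zero_bracket, zero_add]
      exact lie_mem_derivedEvenBracket _ _

end Decomposition

/-! ### Vanishing of `δ` on `[s,L]` and on brackets with it, and the conclusion -/

section Biderivation

variable {L : Type*} [AddCommGroup L] [Module ℂ L] [LieSuperalgebra L] {d : ZMod 2}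
  {δ : L →ₗ[ℂ] L →ₗ[ℂ] L}
  [FiniteDimensional ℂ L] [LieAlgebra.HasTrivialRadical ℂ (derivedEven L)]
  (hδ : IsSuperBiderivation d δ) (hsymm : IsSuperSymmetric δ)

include hδ hsymm

lemma apply_mem_invariants (v w : L) : δ v w ∈ invariants L :=
  fun x ↦ derivedEven_lie_apply hδ hsymm x v w

lemma apply_of_mem_derivedEvenBracket {u : L} (hu : u ∈ derivedEvenBracket L) : δ u = 0 := by
  refine Submodule.span_le (p := LinearMap.ker δ).mpr ?_ hu
  rintro _ ⟨x, v, rfl⟩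
  refine LinearMap.ext fun w ↦ ?_
  rw [apply_lie_left hδ hsymm, derivedEven_lie_apply hδ hsymm, LinearMap.zero_apply]

lemma apply_bracket_of_mem_derivedEvenBracket {u v : L} (hu : u ∈ odd L)
    (hu' : u ∈ derivedEvenBracket L) (hv : v ∈ odd L) : δ ⁅u, v⁆ = 0 := by
  ext w
  induction w using homogeneous_induction with
  | h k w hw =>
    refine Submodule.disjoint_def.mp isCompl_derivedEvenBracket_invariants.disjoint _ ?_
      (apply_mem_invariants hδ hsymm _ _)
    have h := bracket_mem_derivedEvenBracket hu' (apply_mem_invariants hδ hsymm v w)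
    rw [hδ.left_derivation hu hv hw, apply_of_mem_derivedEvenBracket hδ hsymm hu',
      LinearMap.zero_apply, bracket_zero, smul_zero, sub_zero]
    rcases Int.units_eq_one_or ((-1 : ℤˣ) ^ (d * 1)) with h1 | h1 <;> rw [h1]
    · rwa [one_smul]
    · rw [Units.neg_smul, one_smul]
      exact neg_mem h
  | hadd w w' h h' => rw [map_add, h, h', map_add]

end Biderivation

end LieSuperalgebra

open LieSuperalgebra in
theorem mainTheorem7 {L : Type*} [AddCommGroup L] [Module ℂ L] [LieSuperalgebra L]
    [FiniteDimensional ℂ L]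
    (hperf : LieSuperalgebra.IsPerfect L)
    (hred : LieSuperalgebra.IsReductiveLieAlgebra (LieSuperalgebra.even L))
    (hdim : Module.finrank ℂ (LieSuperalgebra.oddInvariants L) ≤ 1)
    (d : ZMod 2) (δ : L →ₗ[ℂ] L →ₗ[ℂ] L)
    (hδ : LieSuperalgebra.IsSuperBiderivation d δ)
    (hsymm : LieSuperalgebra.IsSuperSymmetric δ) :
    δ = 0 := by
  have : LieAlgebra.HasTrivialRadical ℂ (derivedEven L) :=
    LieAlgebra.hasTrivialRadical_derived hred
  obtain ⟨⟨v, hv⟩, hspan⟩ := finrank_le_one_iff.mp hdim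
  replace hspan (w : L) (hw : w ∈ oddInvariants L) : ∃ r : ℂ, r • v = w :=
    (hspan ⟨w, hw⟩).imp fun r hr ↦ congrArg Subtype.val hr
  have hvv := bracket_self_eq_zero_of_oddInvariants hperf hred hv hspan
  have h11 (x : L) (hx : x ∈ odd L) (y : L) (hy : y ∈ odd L) : δ ⁅x, y⁆ = 0 := by
    obtain ⟨p, hp, hp', q, hq, rfl⟩ := exists_oddInvariants_add hx
    obtain ⟨p', hpo, hpd, q', hq', rfl⟩ := exists_oddInvariants_add hy
    obtain ⟨r, rfl⟩ := hspan q hq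
    obtain ⟨r', rfl⟩ := hspan q' hq'
    rw [add_bracket, map_add, apply_bracket_of_mem_derivedEvenBracket hδ hsymm hp hp' hy, zero_add,
      bracket_add, map_add, odd_bracket_comm hq.1 hpo,
      apply_bracket_of_mem_derivedEvenBracket hδ hsymm hpo hpd hq.1, zero_add, smul_bracket,
      bracket_smul, hvv, smul_zero, smul_zero, map_zero]
  have h0 (x : L) (hx : x ∈ even L) : δ x = 0 := by
    -- Perfectness makes the even part equal to `[even, even] + [odd, odd]`, and `δ` kills both
    -- terms.
    have h := mem_of_isPerfect hperf (N := (even L ⊓ LinearMap.ker δ) ⊔ odd L)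
      (fun a ha b hb ↦ Submodule.mem_sup_left ⟨even_bracket_even ha hb, ?_⟩)
      (fun a ha b hb ↦ Submodule.mem_sup_right (even_bracket_odd ha hb))
      (fun a ha b hb ↦ Submodule.mem_sup_left ⟨odd_bracket_odd ha hb, h11 a ha b hb⟩) x
    · obtain ⟨e, ⟨he, he'⟩, o, ho, heo⟩ := Submodule.mem_sup.mp h
      have h' : e + o = x + 0 := by rw [heo, add_zero]
      rw [← (eq_of_even_add_odd_eq he hx ho (zero_mem _) h').1]
      exact he'
    · exact LinearMap.ext fun w ↦ apply_derivedEven hδ hsymm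
        ⟨⁅⟨a, ha⟩, ⟨b, hb⟩⁆, LieSubmodule.lie_mem_lie (I := (⊤ : LieIdeal ℂ (even L)))
          (N := (⊤ : LieIdeal ℂ (even L))) (LieSubmodule.mem_top _) (LieSubmodule.mem_top _)⟩ w
  have h1 (x : L) (hx : x ∈ odd L) (y : L) (hy : y ∈ odd L) : δ x y = 0 := by
    obtain ⟨p, hp, hp', q, hq, rfl⟩ := exists_oddInvariants_add hx
    obtain ⟨p', hpo, hpd, q', hq', rfl⟩ := exists_oddInvariants_add hy
    obtain ⟨r, rfl⟩ := hspan q hq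
    obtain ⟨r', rfl⟩ := hspan q' hq'
    rw [map_add δ, apply_of_mem_derivedEvenBracket hδ hsymm hp', zero_add, map_add,
      hsymm hq.1 hpo, apply_of_mem_derivedEvenBracket hδ hsymm hpd]
    simp [hsymm.apply_odd hv.1]
  refine LinearMap.ext fun x ↦ LinearMap.ext fun y ↦ ?_
  obtain ⟨a, ha, b, hb, rfl⟩ := exists_even_add_odd x
  obtain ⟨c, hc, e, he, rfl⟩ := exists_even_add_odd y
  rw [map_add δ, h0 a ha, zero_add, map_add, h1 b hb e he, ← hsymm.apply_even hc, h0 c hc]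
  simp
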